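/- Let $R$ be a unital commutative ring. Let $(\mathcal B,\mathcal L,\theta,\mathcal I,\mathcal J)$ be a relative generalized Boolean dynamical system. That is: - $\mathcal B$ is a generalized Boolean algebra (a distributive lattice with least element $\emptyset$ and relative complements) and $\mathcal L$ is a set. - $\theta=(\theta_\alpha)_{\alpha\in\mathcal L}$ is a family of maps $\theta_\alpha:\mathcal B\to\mathcal B$ preserving $\emptyset,\cup,\cap,\setminus$. - $\mathcal I=(\mathcal I_\alpha)_{\alpha\in\mathcal L}$ is a family of ideals of $\mathcal B$ (an ideal is a nonempty subset closed under $\cup$ and under $\cap$ with arbitrary elements of $\mathcal B$), and $A\in\mathcal I_\alpha$ whenever $A\subseteq\theta_\alpha(B)$ for some $B\in\mathcal B$. - Put $\Delta_A=\{\alpha\in\mathcal L:\theta_\alpha(A)\neq\emptyset\}$ and $\mathcal B_{\mathrm{reg}}=\{A\in\mathcal B: 0<|\Delta_B|<\infty \text{ for all } \emptyset\neq B\subseteq A\}$. Then $\mathcal J$ is an ideal of $\mathcal B_{\mathrm{reg}}$. Let $L_R(\mathcal B,\mathcal L,\theta,\mathcal I,\mathcal J)$ be the universal associative (not necessarily unital)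 $R$-algebra generated by symbols $p_A$ ($A\in\mathcal B$) and $s_{\alpha,B},s_{\alpha,B}^*$ ($\alpha\in\mathcal L$, $B\in\mathcal I_\alpha$) subject to the following relations: 1. $p_\emptyset=0$, $p_{A\cap A'}=p_Ap_{A'}$, $p_{A\cup A'}=p_A+p_{A'}-p_{A\cap A'}$; 2. $p_As_{\alpha,B}=s_{\alpha,B}p_{\theta_\alpha(A)}$, $s_{\alpha,B}^*p_A=p_{\theta_\alpha(A)}s_{\alpha,B}^*$; 3. $s_{\alpha,B}^*s_{\alpha,B'}=p_{B\cap B'}$, and $s_{\alpha,B}^*s_{\alpha',B'}=0$ if $\alpha\neq\alpha'$; 4. $s_{\alpha,B}p_{B'}=s_{\alpha,B\cap B'}$, $p_{B'}s_{\alpha,B}^*=s_{\alpha,B\cap B'}^*$; 5. $p_A=\sum_{\alpha\in\Delta_A}s_{\alpha,\theta_\alpha(A)}s_{\alpha,\theta_\alpha(A)}^*$ for all $A\in\mathcal J$. It is $\mathbb Z$-graded with $p_A$ in degree $0$, $s_{\alpha,B}$ in degree $1$ and $s_{\alpha,B}^*$ in degree $-1$. For $A\in\mathcal B_{\mathrm{reg}}$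 let $q_A=p_A-\sum_{\alpha\in\Delta_A}s_{\alpha,\theta_\alpha(A)}s_{\alpha,\theta_\alpha(A)}^*$. Let $E$ be a $\mathbb Z$-graded associative (not necessarily unital) $R$-algebra, and let $f:L_R(\mathcal B,\mathcal L,\theta,\mathcal I,\mathcal J)\to E$ be a $\mathbb Z$-graded homomorphism of $R$-algebras. Then $f$ is injective if and only if both of the following hold: - $f(rp_A)\neq 0$ for all $\emptyset\neq A\in\mathcal B$ and all $0\neq r\in R$; - $f(rq_A)\neq 0$ for all $A\in\mathcal B_{\mathrm{reg}}\setminus\mathcal J$ and all $0\neq r\in R$. -/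

import Mathlib

universe u v w

/-- A relative generalized Boolean dynamical system `(B, L, θ, I, J)` over the generalized Boolean
algebra `B` and the alphabet `L`.  Each `θ α` preserves `⊥`, `⊔`, `⊓` (hence also relative
complements, see `RelBooleanSystem.action_sdiff`); each `ideal α` is an ideal of `B` containing
everything that lies below some `θ α B`; `J` is an ideal of the generalized Boolean algebra of
regular elements, that is, an ideal of `B` all of whose elements are regular. -/
structure RelBooleanSystem (B : Type u) [GeneralizedBooleanAlgebra B] (L : Type v) where
  action : L → LatticeHom B B
  action_bot : ∀ α, action α ⊥ = ⊥
  ideal : L → Order.Ideal B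
  mem_ideal_of_le : ∀ (α : L) (A C : B), A ≤ action α C → A ∈ ideal α
  J : Order.Ideal B
  regular_of_mem_J : ∀ A ∈ J, ∀ C ≤ A, C ≠ ⊥ →
    {α : L | action α C ≠ ⊥}.Nonempty ∧ {α : L | action α C ≠ ⊥}.Finite

noncomputable section

namespace RelBooleanSystem

variable {B : Type u} [GeneralizedBooleanAlgebra B] {L : Type v} (D : RelBooleanSystem B L)

theorem action_sdiff (α : L) (A C : B) :
    D.action α (A \ C) = D.action α A \ D.action α C := by
  symm
  apply sdiff_unique
  · rw [← map_inf, ← map_sup, sup_inf_sdiff]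
  · rw [← map_inf, ← map_inf, inf_inf_sdiff, D.action_bot]

/-- `Δ_A`, the set of letters `α` with `θ_α(A) ≠ ∅`. -/
def delta (A : B) : Set L := {α | D.action α A ≠ ⊥}

/-- `A ∈ B_reg`: for every nonempty `C ⊆ A`, the set `Δ_C` is nonempty and finite. -/
def IsRegular (A : B) : Prop := ∀ C ≤ A, C ≠ ⊥ → (D.delta C).Nonempty ∧ (D.delta C).Finite

variable {D} in
theorem IsRegular.finite_delta {A : B} (hA : D.IsRegular A) : (D.delta A).Finite := by
  by_cases h : A = ⊥
  · subst h
    have : D.delta ⊥ = ∅ := by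
      ext α
      simp [delta, D.action_bot]
    rw [this]
    exact Set.finite_empty
  · exact (hA A le_rfl h).2

theorem isRegular_of_mem_J {A : B} (hA : A ∈ D.J) : D.IsRegular A :=
  D.regular_of_mem_J A hA

/-- `θ_α(A)` as an element of the ideal `I_α`. -/
def range (α : L) (A : B) : D.ideal α :=
  ⟨D.action α A, D.mem_ideal_of_le α _ A le_rfl⟩

/-- `C ∩ A` as an element of the ideal `I_α`, for `C ∈ I_α`. -/
def cut {α : L} (C : D.ideal α) (A : B) : D.ideal α :=
  ⟨(C : B) ⊓ A, (D.ideal α).lower inf_le_left C.2⟩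

/-- The generating symbols `p_A` for `A ∈ B`, and `s_{α,A}`, `s_{α,A}^*` for `A ∈ I_α`. -/
inductive Gen : Type (max u v)
  | p (A : B) : Gen
  | s (α : L) (A : D.ideal α) : Gen
  | sStar (α : L) (A : D.ideal α) : Gen

variable (R : Type w) [CommRing R]

/-- The free associative, not necessarily unital, `R`-algebra on the generating symbols: its basis
consists of the nonempty words in these symbols. -/
abbrev FreeAlg := MonoidAlgebra R (FreeSemigroup D.Gen)

/-- A generating symbol as an element of the free algebra. -/
def gen (g : D.Gen) : D.FreeAlg R := MonoidAlgebra.single (FreeSemigroup.of g) 1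

/-- The defining relations. -/
inductive Rel : D.FreeAlg R → D.FreeAlg R → Prop
  | p_bot : Rel (D.gen R (.p ⊥)) 0
  | p_inf (A A' : B) : Rel (D.gen R (.p (A ⊓ A'))) (D.gen R (.p A) * D.gen R (.p A'))
  | p_sup (A A' : B) : Rel (D.gen R (.p (A ⊔ A')))
      (D.gen R (.p A) + D.gen R (.p A') - D.gen R (.p (A ⊓ A')))
  | p_mul_s (A : B) (α : L) (C : D.ideal α) : Rel (D.gen R (.p A) * D.gen R (.s α C))
      (D.gen R (.s α C) * D.gen R (.p (D.action α A)))
  | sStar_mul_p (A : B) (α : L) (C : D.ideal α) : Rel (D.gen R (.sStar α C) * D.gen R (.p A))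
      (D.gen R (.p (D.action α A)) * D.gen R (.sStar α C))
  | sStar_mul_s_same (α : L) (C C' : D.ideal α) :
      Rel (D.gen R (.sStar α C) * D.gen R (.s α C')) (D.gen R (.p ((C : B) ⊓ (C' : B))))
  | sStar_mul_s_ne (α α' : L) (hne : α ≠ α') (C : D.ideal α) (C' : D.ideal α') :
      Rel (D.gen R (.sStar α C) * D.gen R (.s α' C')) 0
  | s_mul_p (α : L) (C : D.ideal α) (A : B) :
      Rel (D.gen R (.s α C) * D.gen R (.p A)) (D.gen R (.s α (D.cut C A)))
  | p_mul_sStar (α : L) (C : D.ideal α) (A : B) :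
      Rel (D.gen R (.p A) * D.gen R (.sStar α C)) (D.gen R (.sStar α (D.cut C A)))
  | p_eq_sum (A : B) (hA : A ∈ D.J) : Rel (D.gen R (.p A))
      (∑ α ∈ (D.isRegular_of_mem_J hA).finite_delta.toFinset,
        D.gen R (.s α (D.range α A)) * D.gen R (.sStar α (D.range α A)))

/-- The smallest `R`-algebra congruence on the free algebra containing the defining relations. -/
inductive Cong : D.FreeAlg R → D.FreeAlg R → Prop
  | of {x y : D.FreeAlg R} : Rel D R x y → Cong x y
  | refl (x : D.FreeAlg R) : Cong x x
  | symm {x y : D.FreeAlg R} : Cong x y → Cong y x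
  | trans {x y z : D.FreeAlg R} : Cong x y → Cong y z → Cong x z
  | add {x y x' y' : D.FreeAlg R} : Cong x y → Cong x' y' → Cong (x + x') (y + y')
  | mul {x y x' y' : D.FreeAlg R} : Cong x y → Cong x' y' → Cong (x * x') (y * y')
  | smul (r : R) {x y : D.FreeAlg R} : Cong x y → Cong (r • x) (r • y)

/-- `Cong` as a ring congruence. -/
def ringCon : RingCon (D.FreeAlg R) where
  r := D.Cong R
  iseqv := ⟨.refl, .symm, .trans⟩
  add' := .add
  mul' := .mul

/-- The (associative, not necessarily unital) `R`-algebra `L_R(B, L, θ, I, J)`: the universal one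
on the generating symbols subject to the defining relations. -/
def Alg : Type (max u v w) := (D.ringCon R).Quotient

instance : NonUnitalRing (D.Alg R) := inferInstanceAs (NonUnitalRing (D.ringCon R).Quotient)

/-- The quotient map from the free algebra. -/
def quot : D.FreeAlg R →ₙ+* D.Alg R where
  toFun x := ((x : (D.ringCon R).Quotient))
  map_zero' := rfl
  map_add' _ _ := rfl
  map_mul' _ _ := rfl

theorem quot_surjective : Function.Surjective (D.quot R) := Quotient.mk_surjective

instance : SMul R (D.Alg R) :=
  ⟨fun r => Quotient.map (fun x => r • x) fun _ _ h => Cong.smul r h⟩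

theorem quot_smul (r : R) (x : D.FreeAlg R) : D.quot R (r • x) = r • D.quot R x := rfl

instance : Module R (D.Alg R) :=
  Function.Surjective.module R (D.quot R : D.FreeAlg R →+ D.Alg R) (D.quot_surjective R) (D.quot_smul R)

instance : IsScalarTower R (D.Alg R) (D.Alg R) where
  smul_assoc r x y := by
    obtain ⟨x, rfl⟩ := D.quot_surjective R x
    obtain ⟨y, rfl⟩ := D.quot_surjective R y
    simp only [smul_eq_mul, ← quot_smul, ← map_mul, smul_mul_assoc]

instance : SMulCommClass R (D.Alg R) (D.Alg R) where
  smul_comm r x y := by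
    obtain ⟨x, rfl⟩ := D.quot_surjective R x
    obtain ⟨y, rfl⟩ := D.quot_surjective R y
    simp only [smul_eq_mul, ← quot_smul, ← map_mul, mul_smul_comm]

/-- The element `p_A` of the algebra. -/
def p (A : B) : D.Alg R := D.quot R (D.gen R (.p A))

/-- The element `s_{α,A}` of the algebra. -/
def s (α : L) (A : D.ideal α) : D.Alg R := D.quot R (D.gen R (.s α A))

/-- The element `s_{α,A}^*` of the algebra. -/
def sStar (α : L) (A : D.ideal α) : D.Alg R := D.quot R (D.gen R (.sStar α A))

/-- `q_A = p_A - ∑_{α ∈ Δ_A} s_{α,θ_α(A)} s_{α,θ_α(A)}^*`, for `A` with `Δ_A` finite. -/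
def q (A : B) (hA : (D.delta A).Finite) : D.Alg R :=
  D.p R A - ∑ α ∈ hA.toFinset, D.s R α (D.range α A) * D.sStar R α (D.range α A)

/-- The degree of a generating symbol: `0` for `p_A`, `1` for `s_{α,A}`, `-1` for `s_{α,A}^*`. -/
def genDegree : D.Gen → ℤ
  | .p _ => 0
  | .s _ _ => 1
  | .sStar _ _ => -1

/-- The degree of a word: the sum of the degrees of its symbols. -/
def wordDegree (x : FreeSemigroup D.Gen) : ℤ :=
  Multiplicative.toAdd (FreeSemigroup.lift (fun g => Multiplicative.ofAdd (D.genDegree g)) x)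

/-- The homogeneous component of degree `n` of the `ℤ`-grading of `L_R(B, L, θ, I, J)`: the
`R`-span of the products of generators of total degree `n`. -/
def gradedPart (n : ℤ) : Submodule R (D.Alg R) :=
  Submodule.span R {a | ∃ x : FreeSemigroup D.Gen, D.wordDegree x = n ∧
    a = D.quot R (MonoidAlgebra.single x 1)}

end RelBooleanSystem

end

/-! Necessity. It must be shown that `r • p_A` and `r • q_A` are nonzero in the algebra itself,
which needs a concrete representation. The algebra acts on `R`-valued functions on boundary paths,
i.e. sequences of letters and characters of `B` that may stop only at a character vanishing on `J`.
There `p_A` multiplies by the indicator of the paths whose initial character contains `A`, and `q_A`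
(for finite `Δ_A`) by the indicator of those among them that have no first letter. The prime ideal
theorem supplies a path of the first kind for every `A ≠ ⊥`, and one of the second kind for every `A
∉ J`.

Sufficiency. Since `f` is graded, it is enough to show that a homogeneous `x` with `f x = 0`
vanishes. The tools are the idempotents `e_i = ∑ s_{α,C_α} s_{α,C_α}^*` over finite sets of letters.
They commute with every `p_A` and, for large `i`, fix any given combination of elements `s_{α,C} y`
from the left. For positive degree, `x = e_i x`, and every `s_{α,C}^* x` has smaller degree and lies
in the kernel, so induction gives `x = 0`; negative degree is symmetric.

Degree zero is filtered by the length of monomials. In length zero, `x` is a combination of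
projections, hence locally a scalar multiple of some `p_A`. Otherwise `x = x₀ + y`, with `x₀` a
combination of projections and `y = e_i y e_i` eventually. Induction on the elements `s^* x s` gives
`e_i x e_i = 0`, so `x = x₀ - e_i x₀` for all large `i`. Where `x₀` is a scalar `r` on `A`, this
reads `r • (p_A - e_i p_A)`. If it is nonzero, its independence of `i` and the condition on `p`
force `A` to be regular, so it equals `r • q_A`, which vanishes for `A ∈ J` and is excluded by the
condition on `q` otherwise. -/

/-! ### Characters of generalized Boolean algebras -/

/-- A character of a generalized Boolean algebra: a predicate (possibly identically false) that is
compatible with `⊥`, `⊓` and `⊔`. -/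
structure IsCharacter {B : Type*} [GeneralizedBooleanAlgebra B] (χ : B → Prop) : Prop where
  bot : ¬ χ ⊥
  inf : ∀ A C, χ (A ⊓ C) ↔ χ A ∧ χ C
  sup : ∀ A C, χ (A ⊔ C) ↔ χ A ∨ χ C

namespace IsCharacter

variable {B : Type*} [GeneralizedBooleanAlgebra B] {χ : B → Prop}

theorem mono (h : IsCharacter χ) {A C : B} (hAC : A ≤ C) (hA : χ A) : χ C := by
  rw [← inf_eq_left.2 hAC] at hA
  exact ((h.inf _ _).1 hA).2

theorem exists_of_disjoint {F : Order.PFilter B} {I : Order.Ideal B}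
    (hFI : Disjoint (F : Set B) (I : Set B)) :
    ∃ χ : B → Prop, IsCharacter χ ∧ (∀ A ∈ F, χ A) ∧ ∀ A ∈ I, ¬ χ A := by
  obtain ⟨P, hP, hIP, hFP⟩ := DistribLattice.prime_ideal_of_disjoint_filter_ideal hFI
  refine ⟨fun A => A ∉ P, ⟨?_, ?_, ?_⟩, fun A hA => Set.disjoint_left.1 hFP hA,
    fun A hA => not_not.2 (hIP hA)⟩
  · exact not_not.2 P.bot_mem
  · intro A C
    rw [← not_or, not_iff_not]
    exact ⟨hP.mem_or_mem, fun h => h.elim (P.lower inf_le_left) (P.lower inf_le_right)⟩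
  · intro A C
    rw [← not_and_or, not_iff_not, Order.Ideal.sup_mem_iff]

theorem exists_of_not_mem {A : B} {I : Order.Ideal B} (hA : A ∉ I) :
    ∃ χ : B → Prop, IsCharacter χ ∧ χ A ∧ ∀ C ∈ I, ¬ χ C := by
  obtain ⟨χ, h, hF, hI⟩ := exists_of_disjoint (F := Order.PFilter.principal A) (I := I)
    (Set.disjoint_left.2 fun C hC hCI => hA (I.lower hC hCI))
  exact ⟨χ, h, hF A le_rfl, hI⟩

end IsCharacter

noncomputable section

namespace RelBooleanSystem

variable {B : Type u} [GeneralizedBooleanAlgebra B] {L : Type v} (D : RelBooleanSystem B L)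

theorem action_mono (α : L) {A C : B} (h : A ≤ C) : D.action α A ≤ D.action α C :=
  OrderHomClass.mono (D.action α) h

variable {D} in
theorem _root_.IsCharacter.comp_action {χ : B → Prop} (h : IsCharacter χ) (α : L) :
    IsCharacter fun A => χ (D.action α A) where
  bot := by rw [D.action_bot]; exact h.bot
  inf A C := by rw [map_inf]; exact h.inf _ _
  sup A C := by rw [map_sup]; exact h.sup _ _

/-- A compactness argument: if every letter killed some element of `χ`, intersecting `A` with the
killed elements for the finitely many letters of `Δ_A` would give a nonempty `C ≤ A` with `Δ_C`
empty, against regularity of `A`. -/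
theorem exists_letter {χ : B → Prop} (h : IsCharacter χ) {A : B} (hA : A ∈ D.J) (hχ : χ A) :
    ∃ α, ∀ C, χ C → D.action α C ≠ ⊥ := by
  classical
  by_contra! hcon
  choose c hc hc' using hcon
  have key : ∀ S : Finset L, ∃ C ≤ A, χ C ∧ ∀ α ∈ S, D.action α C = ⊥ := by
    intro S
    induction S using Finset.induction_on with
    | empty => exact ⟨A, le_rfl, hχ, by simp⟩
    | insert α S _ ih =>
      obtain ⟨C, hCA, hC, hS⟩ := ih
      refine ⟨C ⊓ c α, inf_le_left.trans hCA, (h.inf _ _).2 ⟨hC, hc α⟩, ?_⟩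
      intro β hβ
      rcases Finset.mem_insert.1 hβ with rfl | hβ
      · exact le_bot_iff.1 ((D.action_mono _ inf_le_right).trans (hc' _).le)
      · exact le_bot_iff.1 ((D.action_mono _ inf_le_left).trans (hS β hβ).le)
  obtain ⟨C, hCA, hC, hS⟩ := key (D.isRegular_of_mem_J hA).finite_delta.toFinset
  obtain ⟨α, hα⟩ := (D.isRegular_of_mem_J hA C hCA fun h0 => h.bot (h0 ▸ hC)).1
  refine hα (hS α ?_)
  rw [Set.Finite.mem_toFinset]
  exact fun h0 => hα (le_bot_iff.1 ((D.action_mono α hCA).trans h0.le))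

/-- The sets `θ_α(C)` with `χ C` generate a proper filter for the letter just found, and any
character `η` containing it works. -/
theorem exists_extension {χ : B → Prop} (h : IsCharacter χ) {A : B} (hA : A ∈ D.J) (hχ : χ A) :
    ∃ (α : L) (η : B → Prop), IsCharacter η ∧ (∀ C, χ C ↔ η (D.action α C)) ∧
      ∃ C ∈ D.ideal α, η C := by
  obtain ⟨α, hα⟩ := D.exists_letter h hA hχ
  have hF : Order.IsPFilter {E : B | ∃ C, χ C ∧ D.action α C ≤ E} := by
    refine Order.IsPFilter.of_def ⟨_, A, hχ, le_rfl⟩ ?_ ?_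
    · rintro E ⟨C, hC, hE⟩ E' ⟨C', hC', hE'⟩
      refine ⟨D.action α (C ⊓ C'), ⟨C ⊓ C', (h.inf _ _).2 ⟨hC, hC'⟩, le_rfl⟩,
        (D.action_mono α inf_le_left).trans hE, (D.action_mono α inf_le_right).trans hE'⟩
    · rintro E E' hEE ⟨C, hC, hE⟩
      exact ⟨C, hC, hE.trans hEE⟩
  obtain ⟨η, hη, hηF, -⟩ := IsCharacter.exists_of_disjoint (F := hF.toPFilter)
    (I := Order.Ideal.principal ⊥) (Set.disjoint_left.2 fun E hE hE' => by
      obtain ⟨C, hC, hCE⟩ := hE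
      exact hα C hC (le_bot_iff.1 (hCE.trans hE')))
  have h1 : ∀ C, χ C → η (D.action α C) := fun C hC => hηF _ ⟨C, hC, le_rfl⟩
  refine ⟨α, η, hη, fun C => ⟨h1 C, fun hC => ?_⟩, D.action α A,
    D.mem_ideal_of_le α _ A le_rfl, h1 A hχ⟩
  -- Characters are maximal: if `χ C` fails, then `χ (A \ C)` holds, so `η` would contain the
  -- disjoint elements `θ_α(A \ C)` and `θ_α(C)`.
  by_contra hC'
  rw [← sup_inf_sdiff A C, h.sup, h.inf] at hχ
  rcases hχ with h2 | h2
  · exact hC' h2.2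
  · refine hη.bot ?_
    have h3 := (hη.inf _ _).2 ⟨h1 _ h2, hC⟩
    rwa [← map_inf, inf_comm, inf_sdiff_self_right, D.action_bot] at h3

/-! ### Boundary paths -/

/-- Compatibility of two consecutive entries of a boundary path: a letter transports characters,
and a path may only terminate at a character that vanishes on `J`. -/
def Linked (x y : Option L × (B → Prop)) : Prop :=
  IsCharacter x.2 ∧ (x.1 = none → ∀ A ∈ D.J, ¬ x.2 A) ∧
    ∀ α, x.1 = some α → (∀ A, x.2 A ↔ y.2 (D.action α A)) ∧ ∃ C ∈ D.ideal α, y.2 C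

/-- Boundary paths; what comes after the first missing letter is irrelevant. -/
def BPath : Type (max u v) := {x : ℕ → Option L × (B → Prop) // ∀ n, D.Linked (x n) (x (n + 1))}

namespace BPath

variable {D}

/-- The character at which a path starts. -/
def point (x : D.BPath) : B → Prop := (x.1 0).2

/-- The first letter of a path. -/
def head (x : D.BPath) : Option L := (x.1 0).1

/-- The path with its first entry removed. -/
def tail (x : D.BPath) : D.BPath := ⟨fun n => x.1 (n + 1), fun n => x.2 (n + 1)⟩

/-- The path with one more letter in front. -/
def cons (α : L) (x : D.BPath) (h : ∃ C ∈ D.ideal α, x.point C) : D.BPath :=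
  ⟨fun n => Nat.casesOn n (some α, fun A => x.point (D.action α A)) x.1, fun n => by
    cases n with
    | zero =>
      refine ⟨(x.2 0).1.comp_action α, by simp, fun β hβ => ?_⟩
      obtain rfl : α = β := Option.some.inj hβ
      exact ⟨fun A => Iff.rfl, h⟩
    | succ n => exact x.2 n⟩

theorem isCharacter (x : D.BPath) : IsCharacter x.point := (x.2 0).1

@[simp] theorem head_cons (α : L) (x : D.BPath) (h) : (cons α x h).head = some α := rfl

@[simp] theorem tail_cons (α : L) (x : D.BPath) (h) : (cons α x h).tail = x := rfl

@[simp] theorem point_cons (α : L) (x : D.BPath) (h) (A : B) :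
    (cons α x h).point A = x.point (D.action α A) := rfl

theorem point_iff_of_head {x : D.BPath} {α : L} (h : x.head = some α) (A : B) :
    x.point A ↔ x.tail.point (D.action α A) := ((x.2 0).2.2 α h).1 A

theorem cons_tail {x : D.BPath} {α : L} (h : x.head = some α) (h') : cons α x.tail h' = x := by
  apply Subtype.ext
  funext n
  cases n with
  | zero => exact Prod.ext h.symm (funext fun A => propext (point_iff_of_head h A).symm)
  | succ n => rfl

theorem head_ne_none {x : D.BPath} {A : B} (hA : A ∈ D.J) (h : x.point A) : x.head ≠ none :=
  fun h' => (x.2 0).2.1 h' A hA h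

theorem exists_terminal {A : B} (hA : A ∉ D.J) : ∃ x : D.BPath, x.head = none ∧ x.point A := by
  obtain ⟨χ, h, hχ, hJ⟩ := IsCharacter.exists_of_not_mem hA
  -- The path ends at once; repeating its only entry is mere padding.
  exact ⟨⟨fun _ => (none, χ), fun _ => ⟨h, fun _ => hJ, by simp⟩⟩, rfl, hχ⟩

theorem exists_point {A : B} (hA : A ≠ ⊥) : ∃ x : D.BPath, x.point A := by
  have step : ∀ χ : {χ : B → Prop // IsCharacter χ}, ∃ (a : Option L)
      (η : {χ : B → Prop // IsCharacter χ}), D.Linked (a, χ.1) (none, η.1) := by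
    rintro ⟨χ, h⟩
    by_cases hJ : ∀ A ∈ D.J, ¬ χ A
    · exact ⟨none, ⟨χ, h⟩, h, fun _ => hJ, by simp⟩
    · push Not at hJ
      obtain ⟨C, hC, hχ⟩ := hJ
      obtain ⟨α, η, hη, h1, h2⟩ := D.exists_extension h hC hχ
      refine ⟨some α, ⟨η, hη⟩, h, by simp, fun β hβ => ?_⟩
      obtain rfl : α = β := Option.some.inj hβ
      exact ⟨h1, h2⟩
  choose a η hη using step
  obtain ⟨χ, h, hχ, -⟩ := IsCharacter.exists_of_not_mem
    (A := A) (I := Order.Ideal.principal ⊥) (fun h0 => hA (le_bot_iff.1 h0))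
  refine ⟨⟨fun n => (a (η^[n] ⟨χ, h⟩), (η^[n] ⟨χ, h⟩).1), fun n => ?_⟩, hχ⟩
  have := hη (η^[n] ⟨χ, h⟩)
  rw [← Function.iterate_succ_apply' η] at this
  exact this

end BPath

/-! ### The representation on functions of boundary paths -/

variable (R : Type w) [CommRing R]

open Classical in
/-- The action of `p_A` on functions of boundary paths. -/
def pOp (A : B) : Module.End R (D.BPath → R) where
  toFun g x := if x.point A then g x else 0
  map_add' g h := by funext x; by_cases hx : x.point A <;> simp [hx]
  map_smul' r g := by funext x; by_cases hx : x.point A <;> simp [hx]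

open Classical in
/-- The action of `s_{α,A}` on functions of boundary paths. -/
def sOp (α : L) (C : D.ideal α) : Module.End R (D.BPath → R) where
  toFun g x := if x.head = some α ∧ x.tail.point C then g x.tail else 0
  map_add' g h := by
    funext x; dsimp only [Pi.add_apply]; split_ifs <;> simp
  map_smul' r g := by
    funext x; dsimp only [Pi.smul_apply, RingHom.id_apply]; split_ifs <;> simp

open Classical in
/-- The action of `s_{α,A}^*` on functions of boundary paths. -/
def sStarOp (α : L) (C : D.ideal α) : Module.End R (D.BPath → R) where
  toFun g x := if h : x.point C then g (BPath.cons α x ⟨C, C.2, h⟩) else 0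
  map_add' g h := by funext x; by_cases hx : x.point C <;> simp [hx]
  map_smul' r g := by funext x; by_cases hx : x.point C <;> simp [hx]

/-- The action of the generating symbols on functions of boundary paths. -/
def genOp : D.Gen → Module.End R (D.BPath → R)
  | .p A => D.pOp R A
  | .s α C => D.sOp R α C
  | .sStar α C => D.sStarOp R α C

/-- The representation of the free algebra on functions of boundary paths. -/
def freeRep : D.FreeAlg R →ₙₐ[R] Module.End R (D.BPath → R) :=
  MonoidAlgebra.liftMagma R (FreeSemigroup.lift (D.genOp R))

@[simp] theorem freeRep_gen (g : D.Gen) : D.freeRep R (D.gen R g) = D.genOp R g := by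
  simp [freeRep, gen, MonoidAlgebra.liftMagma]

/-- Removing the first letter `α` and putting it back restores the path, so the product acts as an
indicator function. -/
theorem sOp_mul_sStarOp_range_apply (α : L) (A : B) (g : D.BPath → R) (x : D.BPath)
    [Decidable (x.head = some α ∧ x.point A)] :
    (D.sOp R α (D.range α A) * D.sStarOp R α (D.range α A)) g x =
      if x.head = some α ∧ x.point A then g x else 0 := by
  by_cases h : x.head = some α
  · have h1 := BPath.point_iff_of_head h A
    by_cases h2 : x.point A
    · have h3 := h1.1 h2
      simp [sOp, sStarOp, range, h, h2, h3, BPath.cons_tail h]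
    · have h3 := mt h1.2 h2
      simp [sOp, sStarOp, range, h2, h3]
  · simp [sOp, h]

theorem freeRep_rel {x y : D.FreeAlg R} (h : D.Rel R x y) : D.freeRep R x = D.freeRep R y := by
  classical
  induction h with
  | p_bot =>
    ext g x
    simp [genOp, pOp, x.isCharacter.bot]
  | p_inf A A' =>
    apply LinearMap.ext; intro g; funext x
    by_cases h1 : x.point A <;> by_cases h2 : x.point A' <;>
      simp [genOp, pOp, x.isCharacter.inf, h1, h2]
  | p_sup A A' =>
    apply LinearMap.ext; intro g; funext x
    by_cases h1 : x.point A <;> by_cases h2 : x.point A' <;>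
      simp [genOp, pOp, x.isCharacter.inf, x.isCharacter.sup, h1, h2]
  | p_mul_s A α C =>
    apply LinearMap.ext; intro g; funext x
    by_cases h : x.head = some α
    · have h1 := BPath.point_iff_of_head h A
      by_cases h2 : x.point A <;> by_cases h3 : x.tail.point C <;>
        simp [genOp, pOp, sOp, h, ← h1, h2, h3]
    · simp [genOp, pOp, sOp, h]
  | sStar_mul_p A α C =>
    apply LinearMap.ext; intro g; funext x
    by_cases h1 : x.point C <;> by_cases h2 : x.point (D.action α A) <;>
      simp [genOp, pOp, sStarOp, h1, h2]
  | sStar_mul_s_same α C C' =>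
    apply LinearMap.ext; intro g; funext x
    by_cases h1 : x.point C <;> by_cases h2 : x.point C' <;>
      simp [genOp, pOp, sOp, sStarOp, x.isCharacter.inf, h1, h2]
  | sStar_mul_s_ne α α' hne C C' =>
    apply LinearMap.ext; intro g; funext x
    simp [genOp, sOp, sStarOp, hne]
  | s_mul_p α C A =>
    apply LinearMap.ext; intro g; funext x
    by_cases h1 : x.tail.point C <;> by_cases h2 : x.tail.point A <;>
      by_cases h3 : x.head = some α <;>
      simp [genOp, pOp, sOp, cut, x.tail.isCharacter.inf, h1, h2, h3]
  | p_mul_sStar α C A =>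
    apply LinearMap.ext; intro g; funext x
    by_cases h1 : x.point C <;> by_cases h2 : x.point A <;>
      simp [genOp, pOp, sStarOp, cut, x.isCharacter.inf, h1, h2]
  | p_eq_sum A hA =>
    apply LinearMap.ext; intro g; funext x
    simp only [map_sum, map_mul, freeRep_gen, genOp, LinearMap.sum_apply, Finset.sum_apply,
      sOp_mul_sStarOp_range_apply]
    by_cases hx : x.point A
    -- A path through `A ∈ J` has a first letter, which lies in `Δ_A`; exactly that summand
    -- survives.
    · obtain ⟨β, hβ⟩ := Option.ne_none_iff_exists'.1 (BPath.head_ne_none hA hx)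
      have hmem : β ∈ (D.isRegular_of_mem_J hA).finite_delta.toFinset := by
        rw [Set.Finite.mem_toFinset]
        intro h0
        exact x.tail.isCharacter.bot (h0 ▸ (BPath.point_iff_of_head hβ A).1 hx)
      rw [Finset.sum_eq_single_of_mem β hmem]
      · simp [pOp, hx, hβ]
      · intro γ _ hγ
        rw [if_neg]
        rintro ⟨h, -⟩
        exact hγ (Option.some.inj (h.symm.trans hβ))
    · simp [pOp, hx]

theorem freeRep_cong {x y : D.FreeAlg R} (h : D.Cong R x y) : D.freeRep R x = D.freeRep R y := by
  induction h with
  | of h => exact D.freeRep_rel R h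
  | refl => rfl
  | symm _ ih => exact ih.symm
  | trans _ _ ih ih' => exact ih.trans ih'
  | add _ _ ih ih' => rw [map_add, map_add, ih, ih']
  | mul _ _ ih ih' => rw [map_mul, map_mul, ih, ih']
  | smul r _ ih => rw [map_smul, map_smul, ih]

theorem cong_of_quot_eq {x y : D.FreeAlg R} (h : D.quot R x = D.quot R y) : D.Cong R x y :=
  (RingCon.eq (D.ringCon R)).1 h

theorem smul_p_ne_zero {r : R} (hr : r ≠ 0) {A : B} (hA : A ≠ ⊥) : r • D.p R A ≠ 0 := by
  classical
  intro h
  obtain ⟨x, hx⟩ := BPath.exists_point (D := D) hA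
  have h1 : D.quot R (r • D.gen R (.p A)) = D.quot R 0 := by rw [map_zero]; exact h
  have h2 := congrFun (LinearMap.congr_fun (D.freeRep_cong R (D.cong_of_quot_eq R h1))
    (fun _ => (1 : R))) x
  simp [genOp, pOp, hx] at h2
  exact hr h2

theorem smul_q_ne_zero {r : R} (hr : r ≠ 0) {A : B} (hfin : (D.delta A).Finite)
    (hA : A ∉ D.J) : r • D.q R A hfin ≠ 0 := by
  classical
  intro h
  obtain ⟨x, hx0, hx⟩ := BPath.exists_terminal (D := D) hA
  have h1 : D.quot R (r • (D.gen R (.p A) - ∑ α ∈ hfin.toFinset,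
      D.gen R (.s α (D.range α A)) * D.gen R (.sStar α (D.range α A)))) = D.quot R 0 := by
    rw [map_zero, quot_smul, map_sub, map_sum]
    simp only [map_mul]
    exact h
  have h2 := congrFun (LinearMap.congr_fun (D.freeRep_cong R (D.cong_of_quot_eq R h1))
    (fun _ => (1 : R))) x
  rw [map_smul, map_sub, map_sum] at h2
  simp only [map_mul, freeRep_gen, genOp, LinearMap.sum_apply, Finset.sum_apply,
    LinearMap.smul_apply, LinearMap.sub_apply, Pi.smul_apply, Pi.sub_apply,
    sOp_mul_sStarOp_range_apply, hx0] at h2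
  simp [pOp, hx] at h2
  exact hr h2

end RelBooleanSystem

end

namespace RelBooleanSystem

variable {B : Type u} [GeneralizedBooleanAlgebra B] {L : Type v} (D : RelBooleanSystem B L)
  (R : Type w) [CommRing R]

/-! ### The relations in the algebra -/

theorem quot_rel {x y : D.FreeAlg R} (h : D.Rel R x y) : D.quot R x = D.quot R y :=
  (RingCon.eq (D.ringCon R)).2 (Cong.of h)

theorem p_bot : D.p R ⊥ = 0 := (D.quot_rel R .p_bot).trans (map_zero _)

theorem p_inf (A A' : B) : D.p R (A ⊓ A') = D.p R A * D.p R A' := by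
  simpa only [map_mul] using! D.quot_rel R (.p_inf A A')

theorem p_sup (A A' : B) : D.p R (A ⊔ A') = D.p R A + D.p R A' - D.p R (A ⊓ A') := by
  simpa only [map_add, map_sub] using! D.quot_rel R (.p_sup A A')

theorem p_mul_s (A : B) (α : L) (C : D.ideal α) :
    D.p R A * D.s R α C = D.s R α C * D.p R (D.action α A) := by
  simpa only [map_mul] using! D.quot_rel R (.p_mul_s A α C)

theorem sStar_mul_p (A : B) (α : L) (C : D.ideal α) :
    D.sStar R α C * D.p R A = D.p R (D.action α A) * D.sStar R α C := by
  simpa only [map_mul] using! D.quot_rel R (.sStar_mul_p A α C)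

theorem sStar_mul_s_same (α : L) (C C' : D.ideal α) :
    D.sStar R α C * D.s R α C' = D.p R ((C : B) ⊓ (C' : B)) := by
  simpa only [map_mul] using! D.quot_rel R (.sStar_mul_s_same α C C')

theorem sStar_mul_s_ne {α α' : L} (hne : α ≠ α') (C : D.ideal α) (C' : D.ideal α') :
    D.sStar R α C * D.s R α' C' = 0 := by
  simpa only [map_mul, map_zero] using! D.quot_rel R (.sStar_mul_s_ne α α' hne C C')

theorem s_mul_p (α : L) (C : D.ideal α) (A : B) :
    D.s R α C * D.p R A = D.s R α (D.cut C A) := by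
  simpa only [map_mul] using! D.quot_rel R (.s_mul_p α C A)

theorem p_mul_sStar (α : L) (C : D.ideal α) (A : B) :
    D.p R A * D.sStar R α C = D.sStar R α (D.cut C A) := by
  simpa only [map_mul] using! D.quot_rel R (.p_mul_sStar α C A)

theorem p_eq_sum {A : B} (hA : A ∈ D.J) : D.p R A =
    ∑ α ∈ (D.isRegular_of_mem_J hA).finite_delta.toFinset,
      D.s R α (D.range α A) * D.sStar R α (D.range α A) := by
  simpa only [map_mul, map_sum] using! D.quot_rel R (.p_eq_sum A hA)

theorem s_mul_p_of_le {α : L} (C : D.ideal α) {A : B} (h : (C : B) ≤ A) :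
    D.s R α C * D.p R A = D.s R α C := by
  rw [s_mul_p]
  congr 1
  exact Subtype.ext (inf_eq_left.2 h)

theorem p_mul_sStar_of_le {α : L} (C : D.ideal α) {A : B} (h : (C : B) ≤ A) :
    D.p R A * D.sStar R α C = D.sStar R α C := by
  rw [p_mul_sStar]
  congr 1
  exact Subtype.ext (inf_eq_left.2 h)

theorem p_mul_p_of_le {A C : B} (h : A ≤ C) : D.p R A * D.p R C = D.p R A := by
  rw [← p_inf, inf_eq_left.2 h]

theorem p_mul_p_of_ge {A C : B} (h : A ≤ C) : D.p R C * D.p R A = D.p R A := by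
  rw [← p_inf, inf_eq_right.2 h]

theorem sStar_mul_s_cases (α β : L) (C : D.ideal α) (C' : D.ideal β) :
    ∃ A, D.sStar R α C * D.s R β C' = D.p R A := by
  by_cases h : α = β
  · subst h
    exact ⟨_, D.sStar_mul_s_same R α C C'⟩
  · exact ⟨⊥, by rw [D.sStar_mul_s_ne R h, p_bot]⟩

/-! ### Spanning monomials -/

/-- The monomials `s_{α₁,C₁} ⋯ s_{αₘ,Cₘ} p_A s_{β₁,E₁}^* ⋯ s_{βₙ,Eₙ}^*`. -/
inductive Mono : ℕ → ℕ → D.Alg R → Prop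
  | p (A : B) : Mono 0 0 (D.p R A)
  | s {m n : ℕ} {x : D.Alg R} (α : L) (C : D.ideal α) (h : Mono m n x) :
      Mono (m + 1) n (D.s R α C * x)
  | sStar {m n : ℕ} {x : D.Alg R} (α : L) (C : D.ideal α) (h : Mono m n x) :
      Mono m (n + 1) (x * D.sStar R α C)

variable {R D}

theorem Mono.exists_s {m n : ℕ} {x : D.Alg R} (h : D.Mono R (m + 1) n x) :
    ∃ (α : L) (C : D.ideal α) (y : D.Alg R), D.Mono R m n y ∧ x = D.s R α C * y := by
  generalize hk : m + 1 = k at h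
  induction h with
  | p A => omega
  | s α C h ih =>
    obtain rfl := Nat.succ_injective hk
    exact ⟨α, C, _, h, rfl⟩
  | sStar α C h ih =>
    obtain ⟨β, C', y, hy, rfl⟩ := ih hk
    exact ⟨β, C', _, hy.sStar α C, mul_assoc _ _ _⟩

theorem Mono.exists_sStar {m n : ℕ} {x : D.Alg R} (h : D.Mono R m (n + 1) x) :
    ∃ (α : L) (C : D.ideal α) (y : D.Alg R), D.Mono R m n y ∧ x = y * D.sStar R α C := by
  generalize hk : n + 1 = k at h
  induction h with
  | p A => omega
  | sStar α C h ih =>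
    obtain rfl := Nat.succ_injective hk
    exact ⟨α, C, _, h, rfl⟩
  | s α C h ih =>
    obtain ⟨β, C', y, hy, rfl⟩ := ih hk
    exact ⟨β, C', _, hy.s α C, (mul_assoc _ _ _).symm⟩

theorem Mono.p_mul {m n : ℕ} {x : D.Alg R} (h : D.Mono R m n x) (A : B) :
    D.Mono R m n (D.p R A * x) := by
  induction h generalizing A with
  | p A' => rw [← p_inf]; exact .p _
  | s α C h ih => rw [← mul_assoc, p_mul_s, mul_assoc]; exact (ih _).s α C
  | sStar α C h ih => rw [← mul_assoc]; exact (ih A).sStar α C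

/-- An `s^*` on the left cancels against the leading `s`, or, if there is none, moves past the
projection and joins the starred factors. The lengths depend on the case, so only their difference
is recorded. -/
theorem Mono.sStar_mul {m n : ℕ} {x : D.Alg R} (h : D.Mono R m n x) (α : L) (C : D.ideal α) :
    ∃ m' n' : ℕ, (m' : ℤ) - n' = m - n - 1 ∧ D.Mono R m' n' (D.sStar R α C * x) := by
  induction h with
  | p A =>
    refine ⟨0, 1, by simp, ?_⟩
    rw [sStar_mul_p]
    exact (Mono.p _).sStar α C
  | @s m n x β C' h ih =>
    obtain ⟨A, hA⟩ := D.sStar_mul_s_cases R α β C C'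
    refine ⟨m, n, by push_cast; ring, ?_⟩
    rw [← mul_assoc, hA]
    exact h.p_mul A
  | sStar β C' h ih =>
    obtain ⟨m', n', hmn, h'⟩ := ih
    refine ⟨m', n' + 1, by push_cast; linarith, ?_⟩
    rw [← mul_assoc]
    exact h'.sStar β C'

variable (D R)

/-- The class of a word in the generating symbols. -/
noncomputable def word (x : FreeSemigroup D.Gen) : D.Alg R := D.quot R (MonoidAlgebra.single x 1)

theorem word_mul (x y : FreeSemigroup D.Gen) : D.word R (x * y) = D.word R x * D.word R y := by
  simp only [word, ← map_mul, MonoidAlgebra.single_mul_single, mul_one]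

theorem word_of_s (α : L) (C : D.ideal α) :
    D.word R (FreeSemigroup.of (.s α C)) = D.s R α C := rfl

theorem word_of_sStar (α : L) (C : D.ideal α) :
    D.word R (FreeSemigroup.of (.sStar α C)) = D.sStar R α C := rfl

theorem wordDegree_mul (x y : FreeSemigroup D.Gen) :
    D.wordDegree (x * y) = D.wordDegree x + D.wordDegree y := by
  simp [wordDegree]

theorem wordDegree_of (g : D.Gen) : D.wordDegree (FreeSemigroup.of g) = D.genDegree g := by
  simp [wordDegree]

theorem exists_mono_word (x : FreeSemigroup D.Gen) :
    ∃ m n : ℕ, (m : ℤ) - n = D.wordDegree x ∧ D.Mono R m n (D.word R x) := by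
  induction x using FreeSemigroup.recOnMul with
  | ih1 g =>
    rw [wordDegree_of]
    cases g with
    | p A => exact ⟨0, 0, by simp [genDegree], .p A⟩
    | s α C =>
      refine ⟨1, 0, by simp [genDegree], ?_⟩
      rw [word_of_s, ← D.s_mul_p_of_le R C le_rfl]
      exact (Mono.p _).s α C
    | sStar α C =>
      refine ⟨0, 1, by simp [genDegree], ?_⟩
      rw [word_of_sStar, ← D.p_mul_sStar_of_le R C le_rfl]
      exact (Mono.p _).sStar α C
  | ih2 g y _ ih =>
    obtain ⟨m, n, hmn, h⟩ := ih
    rw [wordDegree_mul, wordDegree_of, word_mul]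
    cases g with
    | p A => exact ⟨m, n, by simp [genDegree, hmn], h.p_mul A⟩
    | s α C => exact ⟨m + 1, n, by simp [genDegree]; linarith, h.s α C⟩
    | sStar α C =>
      obtain ⟨m', n', h1, h2⟩ := h.sStar_mul α C
      exact ⟨m', n', by simp [genDegree]; linarith, h2⟩

/-! ### Homogeneous components -/

variable {D R}

theorem word_mem_gradedPart (x : FreeSemigroup D.Gen) :
    D.word R x ∈ D.gradedPart R (D.wordDegree x) :=
  Submodule.subset_span ⟨x, rfl, rfl⟩

theorem mul_mem_gradedPart {m n : ℤ} {x y : D.Alg R} (hx : x ∈ D.gradedPart R m)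
    (hy : y ∈ D.gradedPart R n) : x * y ∈ D.gradedPart R (m + n) := by
  induction hx using Submodule.span_induction with
  | mem x hx =>
    obtain ⟨u, rfl, rfl⟩ := hx
    induction hy using Submodule.span_induction with
    | mem y hy =>
      obtain ⟨v, rfl, rfl⟩ := hy
      rw [← wordDegree_mul, ← word, ← word, ← word_mul]
      exact word_mem_gradedPart _
    | zero => rw [mul_zero]; exact zero_mem _
    | add y z _ _ hy hz => rw [mul_add]; exact add_mem hy hz
    | smul r y _ hy => rw [mul_smul_comm]; exact Submodule.smul_mem _ r hy
  | zero => rw [zero_mul]; exact zero_mem _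
  | add y z _ _ hy hz => rw [add_mul]; exact add_mem hy hz
  | smul r y _ hy => rw [smul_mul_assoc]; exact Submodule.smul_mem _ r hy

theorem s_mem_gradedPart (α : L) (C : D.ideal α) : D.s R α C ∈ D.gradedPart R 1 :=
  Submodule.subset_span ⟨FreeSemigroup.of (.s α C), D.wordDegree_of _, rfl⟩

theorem sStar_mem_gradedPart (α : L) (C : D.ideal α) : D.sStar R α C ∈ D.gradedPart R (-1) :=
  Submodule.subset_span ⟨FreeSemigroup.of (.sStar α C), D.wordDegree_of _, rfl⟩

theorem gradedPart_le_span_mono (k : ℤ) :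
    D.gradedPart R k ≤ Submodule.span R {x | ∃ m n : ℕ, (m : ℤ) - n = k ∧ D.Mono R m n x} := by
  refine Submodule.span_mono ?_
  rintro _ ⟨x, rfl, rfl⟩
  exact D.exists_mono_word R x

theorem quot_single (x : FreeSemigroup D.Gen) (r : R) :
    D.quot R (MonoidAlgebra.single x r) = r • D.word R x := by
  rw [word, ← quot_smul, MonoidAlgebra.smul_single, smul_eq_mul, mul_one]

/-- Only existence of a decomposition is needed: independence of the components is never used in the
domain, only in the graded target. -/
theorem exists_finsupp_gradedPart (x : D.Alg R) :
    ∃ c : ℤ →₀ D.Alg R, (∀ n, c n ∈ D.gradedPart R n) ∧ c.sum (fun _ y => y) = x := by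
  classical
  obtain ⟨x, rfl⟩ := D.quot_surjective R x
  induction x using MonoidAlgebra.induction_linear with
  | zero => exact ⟨0, fun n => zero_mem _, by simp⟩
  | add x y hx hy =>
    obtain ⟨c, hc, hcx⟩ := hx
    obtain ⟨d, hd, hdy⟩ := hy
    refine ⟨c + d, fun n => add_mem (hc n) (hd n), ?_⟩
    rw [Finsupp.sum_add_index' (fun _ => rfl) (fun _ _ _ => rfl), hcx, hdy, map_add]
  | single u r =>
    refine ⟨Finsupp.single (D.wordDegree u) (r • D.word R u), fun n => ?_, ?_⟩
    · rw [Finsupp.single_apply]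
      split_ifs with h
      · subst h
        exact Submodule.smul_mem _ r (word_mem_gradedPart u)
      · exact zero_mem _
    · rw [Finsupp.sum_single_index rfl, quot_single]

end RelBooleanSystem

namespace RelBooleanSystem

open Filter

variable {B : Type u} [GeneralizedBooleanAlgebra B] {L : Type v} (D : RelBooleanSystem B L)
  (R : Type w) [CommRing R]

/-! ### Local left units for the generators `s_{α,A}` -/

/-- A finite set of letters together with an element of every ideal `I_α`. -/
abbrev LocalIndex : Type (max u v) := Finset L × ∀ α, D.ideal α

instance : Nonempty D.LocalIndex := ⟨(∅, fun α => ⟨⊥, (D.ideal α).bot_mem⟩)⟩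

instance : IsDirectedOrder D.LocalIndex where
  directed i j := by
    classical
    exact ⟨(i.1 ∪ j.1, fun α => ⟨i.2 α ⊔ j.2 α, Order.Ideal.sup_mem (i.2 α).2 (j.2 α).2⟩),
      ⟨Finset.subset_union_left, fun α => Subtype.coe_le_coe.1 le_sup_left⟩,
      ⟨Finset.subset_union_right, fun α => Subtype.coe_le_coe.1 le_sup_right⟩⟩

/-- The idempotent `∑_{α ∈ F} s_{α,C_α} s_{α,C_α}^*`. -/
noncomputable def localUnit (i : D.LocalIndex) : D.Alg R :=
  ∑ α ∈ i.1, D.s R α (i.2 α) * D.sStar R α (i.2 α)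

variable {D}

theorem localUnit_mul_s {i : D.LocalIndex} {α : L} {C : D.ideal α} (hα : α ∈ i.1)
    (hC : C ≤ i.2 α) : D.localUnit R i * D.s R α C = D.s R α C := by
  rw [localUnit, Finset.sum_mul, Finset.sum_eq_single_of_mem α hα]
  · rw [mul_assoc, sStar_mul_s_same, s_mul_p]
    congr 1
    apply Subtype.ext
    simp only [cut]
    rw [← inf_assoc, inf_idem]
    exact inf_eq_right.2 hC
  · intro β _ hβ
    rw [mul_assoc, sStar_mul_s_ne _ _ hβ, mul_zero]

theorem sStar_mul_localUnit {i : D.LocalIndex} {α : L} {C : D.ideal α} (hα : α ∈ i.1)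
    (hC : C ≤ i.2 α) : D.sStar R α C * D.localUnit R i = D.sStar R α C := by
  rw [localUnit, Finset.mul_sum, Finset.sum_eq_single_of_mem α hα]
  · rw [← mul_assoc, sStar_mul_s_same, inf_eq_left.2 (Subtype.coe_le_coe.2 hC), p_mul_sStar]
    congr 1
    apply Subtype.ext
    exact inf_eq_right.2 hC
  · intro β _ hβ
    rw [← mul_assoc, sStar_mul_s_ne _ _ hβ.symm, zero_mul]

theorem sStar_mul_localUnit_of_notMem {i : D.LocalIndex} {α : L} (C : D.ideal α) (hα : α ∉ i.1) :
    D.sStar R α C * D.localUnit R i = 0 := by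
  rw [localUnit, Finset.mul_sum]
  refine Finset.sum_eq_zero fun β hβ => ?_
  rw [← mul_assoc, sStar_mul_s_ne _ _ (fun h : α = β => hα (h ▸ hβ)), zero_mul]

theorem localUnit_mul_self (i : D.LocalIndex) :
    D.localUnit R i * D.localUnit R i = D.localUnit R i := by
  conv_lhs => enter [2]; rw [localUnit]
  rw [Finset.mul_sum]
  refine Finset.sum_congr rfl fun α hα => ?_
  rw [← mul_assoc, localUnit_mul_s R hα le_rfl]

theorem localUnit_mul_p (i : D.LocalIndex) (A : B) :
    D.localUnit R i * D.p R A =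
      ∑ α ∈ i.1, D.s R α (D.cut (i.2 α) (D.action α A)) *
        D.sStar R α (D.cut (i.2 α) (D.action α A)) := by
  rw [localUnit, Finset.sum_mul]
  refine Finset.sum_congr rfl fun α _ => ?_
  rw [← s_mul_p, ← p_mul_sStar, mul_assoc, sStar_mul_p, mul_assoc, ← mul_assoc (D.p R _),
    p_mul_p_of_le _ _ le_rfl]

theorem p_mul_localUnit (i : D.LocalIndex) (A : B) :
    D.p R A * D.localUnit R i = D.localUnit R i * D.p R A := by
  rw [localUnit, Finset.sum_mul, Finset.mul_sum]
  refine Finset.sum_congr rfl fun α _ => ?_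
  rw [← mul_assoc, p_mul_s, mul_assoc, mul_assoc, sStar_mul_p]

variable {R}

theorem eventually_localUnit_mul {x : D.Alg R}
    (hx : x ∈ Submodule.span R {x | ∃ (α : L) (C : D.ideal α) (y : D.Alg R),
      x = D.s R α C * y}) :
    ∀ᶠ i in atTop, D.localUnit R i * x = x := by
  classical
  induction hx using Submodule.span_induction with
  | mem x hx =>
    obtain ⟨α, C, y, rfl⟩ := hx
    -- The threshold index has the single letter `α`, with `C` at `α` and `⊥` at every other letter.
    filter_upwards [eventually_ge_atTop (({α}, Function.update (fun α => ⟨⊥, (D.ideal α).bot_mem⟩)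
      α C) : D.LocalIndex)] with i hi
    rw [← mul_assoc, localUnit_mul_s R (hi.1 (Finset.mem_singleton_self α))]
    simpa using hi.2 α
  | zero => exact Eventually.of_forall fun i => mul_zero _
  | add x y _ _ hx hy =>
    filter_upwards [hx, hy] with i hx hy
    rw [mul_add, hx, hy]
  | smul r x _ hx =>
    filter_upwards [hx] with i hx
    rw [mul_smul_comm, hx]

theorem eventually_mul_localUnit {x : D.Alg R}
    (hx : x ∈ Submodule.span R {x | ∃ (α : L) (C : D.ideal α) (y : D.Alg R),
      x = y * D.sStar R α C}) :
    ∀ᶠ i in atTop, x * D.localUnit R i = x := by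
  classical
  induction hx using Submodule.span_induction with
  | mem x hx =>
    obtain ⟨α, C, y, rfl⟩ := hx
    filter_upwards [eventually_ge_atTop (({α}, Function.update (fun α => ⟨⊥, (D.ideal α).bot_mem⟩)
      α C) : D.LocalIndex)] with i hi
    rw [mul_assoc, sStar_mul_localUnit R (hi.1 (Finset.mem_singleton_self α))]
    simpa using hi.2 α
  | zero => exact Eventually.of_forall fun i => zero_mul _
  | add x y _ _ hx hy =>
    filter_upwards [hx, hy] with i hx hy
    rw [add_mul, hx, hy]
  | smul r x _ hx =>
    filter_upwards [hx] with i hx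
    rw [smul_mul_assoc, hx]

theorem eventually_sStar_mul_localUnit (α : L) (C : D.ideal α) :
    ∀ᶠ i in atTop, D.sStar R α C * D.localUnit R i = D.sStar R α C :=
  eventually_mul_localUnit (Submodule.subset_span
    ⟨α, C, D.p R C, (D.p_mul_sStar_of_le R C le_rfl).symm⟩)

theorem localUnit_mul_eq_zero {x : D.Alg R} (h : ∀ α (C : D.ideal α), D.sStar R α C * x = 0)
    (i : D.LocalIndex) : D.localUnit R i * x = 0 := by
  rw [localUnit, Finset.sum_mul]
  exact Finset.sum_eq_zero fun α _ => by rw [mul_assoc, h, mul_zero]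

theorem mul_localUnit_eq_zero {x : D.Alg R} (h : ∀ α (C : D.ideal α), x * D.s R α C = 0)
    (i : D.LocalIndex) : x * D.localUnit R i = 0 := by
  rw [localUnit, Finset.mul_sum]
  exact Finset.sum_eq_zero fun α _ => by rw [← mul_assoc, h, zero_mul]

/-! ### The span of the projections -/

theorem mul_localUnit_comm_of_mem_span_p {x : D.Alg R} (hx : x ∈ Submodule.span R (Set.range (D.p R)))
    (i : D.LocalIndex) : x * D.localUnit R i = D.localUnit R i * x := by
  induction hx using Submodule.span_induction with
  | mem x hx =>
    obtain ⟨C, rfl⟩ := hx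
    exact p_mul_localUnit R i C
  | zero => rw [zero_mul, mul_zero]
  | add x y _ _ hx hy => rw [add_mul, mul_add, hx, hy]
  | smul r x _ hx => rw [smul_mul_assoc, mul_smul_comm, hx]

theorem eventually_p_mul {x : D.Alg R} (hx : x ∈ Submodule.span R (Set.range (D.p R))) :
    ∀ᶠ A in atTop, D.p R A * x = x := by
  induction hx using Submodule.span_induction with
  | mem x hx =>
    obtain ⟨C, rfl⟩ := hx
    filter_upwards [eventually_ge_atTop C] with A hA using D.p_mul_p_of_ge R hA
  | zero => exact Eventually.of_forall fun A => mul_zero _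
  | add x y _ _ hx hy =>
    filter_upwards [hx, hy] with A hx hy
    rw [mul_add, hx, hy]
  | smul r x _ hx =>
    filter_upwards [hx] with A hx
    rw [mul_smul_comm, hx]

/-- Elements of the span of the projections are locally scalar: a property of elements of `B` that
is stable under finite unions holds everywhere if it holds wherever the element is scalar. -/
theorem forall_of_locally_scalar {x : D.Alg R}
    (hx : x ∈ Submodule.span R (Set.range (D.p R))) (Z : B → Prop)
    (hsup : ∀ A C, Z A → Z C → Z (A ⊔ C))
    (hZ : ∀ (A : B) (r : R), D.p R A * x = r • D.p R A → Z A) (A : B) : Z A := by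
  induction hx using Submodule.span_induction generalizing Z A with
  | mem x hx =>
    obtain ⟨C, rfl⟩ := hx
    rw [← sup_inf_sdiff A C]
    refine hsup _ _ (hZ _ 1 ?_) (hZ _ 0 ?_)
    · rw [one_smul, D.p_mul_p_of_le R inf_le_right]
    · rw [zero_smul, ← p_inf, inf_comm, inf_sdiff_self_right, p_bot]
  | zero => exact hZ A 0 (by rw [mul_zero, zero_smul])
  | add x y _ _ hx hy =>
    -- The induction hypothesis for `x` is applied to the hereditary form of `Z`, so that a piece
    -- where `x` is scalar can be cut further into pieces where `y` is scalar too.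
    refine hx (fun A => ∀ A' ≤ A, Z A') ?_ ?_ A A le_rfl
    · intro A C hA hC E hE
      rw [← inf_eq_left.2 hE, inf_sup_left]
      exact hsup _ _ (hA _ inf_le_right) (hC _ inf_le_right)
    · intro A r hr A' hA'
      have h := hy (fun E => Z (E ⊓ A')) (fun E C hE hC => by
        rw [inf_sup_right]; exact hsup _ _ hE hC) ?_ A'
      · rwa [inf_idem] at h
      · intro E t ht
        refine hZ _ (r + t) ?_
        have h1 : D.p R (E ⊓ A') * D.p R A = D.p R (E ⊓ A') :=
          D.p_mul_p_of_le R (inf_le_right.trans hA')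
        have h2 : D.p R (E ⊓ A') * D.p R E = D.p R (E ⊓ A') := D.p_mul_p_of_le R inf_le_left
        rw [mul_add, add_smul]
        congr 1
        · rw [← h1, mul_assoc, hr, mul_smul_comm]
        · rw [← h2, mul_assoc, ht, mul_smul_comm]
  | smul t x _ hx =>
    refine hx Z hsup (fun A r hr => hZ A (t * r) ?_) A
    rw [mul_smul_comm, hr, mul_smul]

theorem p_sup_mul_eq_zero {x : D.Alg R} {A C : B} (hA : D.p R A * x = 0)
    (hC : D.p R C * x = 0) : D.p R (A ⊔ C) * x = 0 := by
  rw [p_sup, p_inf, sub_mul, add_mul, mul_assoc, hA, hC, mul_zero, add_zero, sub_zero]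

/-! ### The filtration of the degree zero part -/

variable (D R) in
/-- The increasing filtration of the degree zero part by the length of monomials. -/
noncomputable def level : ℕ → Submodule R (D.Alg R)
  | 0 => Submodule.span R (Set.range (D.p R))
  | k + 1 => Submodule.span R (Set.range (D.p R)) ⊔
      Submodule.span R {x | ∃ (α : L) (C : D.ideal α) (β : L) (C' : D.ideal β),
        ∃ y ∈ level k, x = D.s R α C * y * D.sStar R β C'}

theorem span_p_le_level (k : ℕ) : Submodule.span R (Set.range (D.p R)) ≤ D.level R k := by
  cases k with
  | zero => exact le_rfl
  | succ k => exact le_sup_left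

theorem p_mem_level (A : B) (k : ℕ) : D.p R A ∈ D.level R k :=
  span_p_le_level k (Submodule.subset_span ⟨A, rfl⟩)

theorem s_mul_mem_level {k : ℕ} {y : D.Alg R} (hy : y ∈ D.level R k) (α : L) (C : D.ideal α)
    (β : L) (C' : D.ideal β) : D.s R α C * y * D.sStar R β C' ∈ D.level R (k + 1) :=
  (le_sup_right : _ ≤ D.level R (k + 1)) (Submodule.subset_span ⟨α, C, β, C', y, hy, rfl⟩)

theorem level_induction {k : ℕ} {P : D.Alg R → Prop} (hp : ∀ A, P (D.p R A)) (h0 : P 0)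
    (hadd : ∀ x y, P x → P y → P (x + y)) (hsmul : ∀ (r : R) x, P x → P (r • x))
    (hs : ∀ (α : L) (C : D.ideal α) (β : L) (C' : D.ideal β), ∀ y ∈ D.level R k,
      P (D.s R α C * y * D.sStar R β C'))
    {x : D.Alg R} (hx : x ∈ D.level R (k + 1)) : P x := by
  rw [level, ← Submodule.span_union] at hx
  induction hx using Submodule.span_induction with
  | mem x hx =>
    rcases hx with ⟨A, rfl⟩ | ⟨α, C, β, C', y, hy, rfl⟩
    · exact hp A
    · exact hs α C β C' y hy
  | zero => exact h0
  | add x y _ _ hx hy => exact hadd x y hx hy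
  | smul r x _ hx => exact hsmul r x hx

theorem level_le_succ (k : ℕ) : D.level R k ≤ D.level R (k + 1) := by
  induction k with
  | zero => exact span_p_le_level 1
  | succ k ih =>
    intro x hx
    exact level_induction (fun A => p_mem_level A _) (zero_mem _) (fun _ _ => add_mem)
      (fun r _ => Submodule.smul_mem _ r)
      (fun α C β C' y hy => s_mul_mem_level (ih hy) α C β C') hx

theorem level_mono : Monotone (D.level R) := monotone_nat_of_le_succ level_le_succ

theorem p_mul_mul_p_mem_level {k : ℕ} {x : D.Alg R} (hx : x ∈ D.level R k) (A A' : B) :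
    D.p R A * x * D.p R A' ∈ D.level R k := by
  cases k with
  | zero =>
    induction hx using Submodule.span_induction with
    | mem x hx =>
      obtain ⟨C, rfl⟩ := hx
      rw [← p_inf, ← p_inf]
      exact p_mem_level _ 0
    | zero => rw [mul_zero, zero_mul]; exact zero_mem _
    | add x y _ _ hx hy => rw [mul_add, add_mul]; exact add_mem hx hy
    | smul r x _ hx => rw [mul_smul_comm, smul_mul_assoc]; exact Submodule.smul_mem _ r hx
  | succ k =>
    refine level_induction (P := fun x => D.p R A * x * D.p R A' ∈ D.level R (k + 1))
      (fun C => ?_) ?_ (fun x y hx hy => ?_) (fun r x hx => ?_)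
      (fun α C β C' y hy => ?_) hx
    · rw [← p_inf, ← p_inf]
      exact p_mem_level _ _
    · rw [mul_zero, zero_mul]; exact zero_mem _
    · rw [mul_add, add_mul]; exact add_mem hx hy
    · rw [mul_smul_comm, smul_mul_assoc]; exact Submodule.smul_mem _ r hx
    · have h : D.p R A * (D.s R α C * y * D.sStar R β C') * D.p R A' =
          D.s R α C * (D.p R (D.action α A) * y * D.p R (D.action β A')) * D.sStar R β C' := by
        rw [← mul_assoc, ← mul_assoc, p_mul_s, mul_assoc _ (D.sStar R β C'), sStar_mul_p]
        simp only [mul_assoc]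
      rw [h]
      exact s_mul_mem_level (p_mul_mul_p_mem_level hy _ _) α C β C'

/-- Each outer factor cancels against its inner neighbour to a projection, which shortens monomials;
this drives the induction on the level. -/
theorem sStar_mul_mul_s_mem_level {k : ℕ} {x : D.Alg R} (hx : x ∈ D.level R (k + 1)) (α : L)
    (C : D.ideal α) (β : L) (C' : D.ideal β) :
    D.sStar R α C * x * D.s R β C' ∈ D.level R k := by
  refine level_induction (P := fun x => D.sStar R α C * x * D.s R β C' ∈ D.level R k)
    (fun A => ?_) ?_ (fun x y hx hy => ?_) (fun r x hx => ?_)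
    (fun γ E γ' E' y hy => ?_) hx
  · obtain ⟨A', hA'⟩ := D.sStar_mul_s_cases R α β C C'
    rw [sStar_mul_p, mul_assoc, hA', ← p_inf]
    exact p_mem_level _ _
  · rw [mul_zero, zero_mul]; exact zero_mem _
  · rw [mul_add, add_mul]; exact add_mem hx hy
  · rw [mul_smul_comm, smul_mul_assoc]; exact Submodule.smul_mem _ r hx
  · obtain ⟨A, hA⟩ := D.sStar_mul_s_cases R α γ C E
    obtain ⟨A', hA'⟩ := D.sStar_mul_s_cases R γ' β E' C'
    rw [← mul_assoc, ← mul_assoc, hA, mul_assoc _ (D.sStar R γ' E'), hA']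
    exact p_mul_mul_p_mem_level hy A A'

theorem Mono.mem_level {m n : ℕ} {x : D.Alg R} (h : D.Mono R m n x) (hmn : m = n) :
    x ∈ D.level R m := by
  subst hmn
  induction m generalizing x with
  | zero =>
    cases h with
    | p A => exact p_mem_level A 0
  | succ m ih =>
    obtain ⟨α, C, y, hy, rfl⟩ := h.exists_s
    obtain ⟨β, C', z, hz, rfl⟩ := hy.exists_sStar
    rw [← mul_assoc]
    exact s_mul_mem_level (ih hz) α C β C'

theorem exists_mem_level {x : D.Alg R} (hx : x ∈ D.gradedPart R 0) : ∃ k, x ∈ D.level R k := by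
  replace hx := gradedPart_le_span_mono 0 hx
  induction hx using Submodule.span_induction with
  | mem x hx =>
    obtain ⟨m, n, hmn, h⟩ := hx
    exact ⟨m, h.mem_level (by omega)⟩
  | zero => exact ⟨0, zero_mem _⟩
  | add x y _ _ hx hy =>
    obtain ⟨k, hk⟩ := hx
    obtain ⟨l, hl⟩ := hy
    exact ⟨max k l, add_mem (level_mono (le_max_left k l) hk) (level_mono (le_max_right k l) hl)⟩
  | smul r x _ hx => exact hx.imp fun k => Submodule.smul_mem _ r

theorem mem_span_s {n : ℕ} {x : D.Alg R} (hx : x ∈ D.gradedPart R (n + 1)) :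
    x ∈ Submodule.span R {x | ∃ (α : L) (C : D.ideal α) (y : D.Alg R), x = D.s R α C * y} := by
  refine Submodule.span_mono ?_ (gradedPart_le_span_mono _ hx)
  rintro x ⟨m, k, hmk, h⟩
  obtain ⟨m, rfl⟩ : ∃ m', m = m' + 1 := ⟨m - 1, by omega⟩
  obtain ⟨α, C, y, -, rfl⟩ := h.exists_s
  exact ⟨α, C, y, rfl⟩

theorem mem_span_sStar {n : ℕ} {x : D.Alg R} (hx : x ∈ D.gradedPart R (-(n + 1))) :
    x ∈ Submodule.span R {x | ∃ (α : L) (C : D.ideal α) (y : D.Alg R),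
      x = y * D.sStar R α C} := by
  refine Submodule.span_mono ?_ (gradedPart_le_span_mono _ hx)
  rintro x ⟨m, k, hmk, h⟩
  obtain ⟨k, rfl⟩ : ∃ k', k = k' + 1 := ⟨k - 1, by omega⟩
  obtain ⟨α, C, y, -, rfl⟩ := h.exists_sStar
  exact ⟨α, C, y, rfl⟩

/-! ### Homomorphisms that do not annihilate the multiples of `p_A` and `q_A` -/

section Uniqueness

variable {E : Type*} [NonUnitalRing E] [Module R E] {f : D.Alg R →ₙₐ[R] E}

theorem eq_zero_of_eventually_eq
    (hp : ∀ r : R, r ≠ 0 → ∀ A : B, A ≠ ⊥ → f (r • D.p R A) ≠ 0)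
    (hq : ∀ r : R, r ≠ 0 → ∀ (A : B) (hA : D.IsRegular A), A ∉ D.J →
      f (r • D.q R A hA.finite_delta) ≠ 0)
    {r : R} {A : B} {z : D.Alg R} (hfz : f z = 0)
    (hz : ∀ᶠ i in atTop, z = r • (D.p R A - D.localUnit R i * D.p R A)) : z = 0 := by
  classical
  by_contra hz0
  obtain ⟨i, hi⟩ := hz.exists
  have hr : r ≠ 0 := by
    rintro rfl
    exact hz0 (by rw [hi, zero_smul])
  -- Here independence of `i` enters: for large `i`, the `s^*` absorbs the idempotent and the two
  -- terms cancel.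
  have hstar : ∀ α (C : D.ideal α), D.sStar R α C * z = 0 := by
    intro α C
    obtain ⟨j, hj, hj'⟩ := (hz.and (eventually_sStar_mul_localUnit (R := R) α C)).exists
    rw [hj, mul_smul_comm, mul_sub, ← mul_assoc, hj', sub_self, smul_zero]
  have hpz : ∀ C ≤ A, D.p R C * z = r • (D.p R C - D.localUnit R i * D.p R C) := by
    intro C hC
    rw [hi, mul_smul_comm, mul_sub, ← mul_assoc, p_mul_localUnit, mul_assoc,
      D.p_mul_p_of_le R hC]
  have hreg : D.IsRegular A := by
    intro C hCA hC
    constructor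
    · by_contra hemp
      have h1 : D.localUnit R i * D.p R C = 0 := by
        rw [localUnit, Finset.sum_mul]
        refine Finset.sum_eq_zero fun α _ => ?_
        have h2 : D.action α C = ⊥ := by
          by_contra h3
          exact hemp ⟨α, h3⟩
        rw [mul_assoc, sStar_mul_p, h2, p_bot, zero_mul, mul_zero]
      refine hp r hr C hC ?_
      rw [← sub_zero (D.p R C), ← h1, ← hpz C hCA, map_mul, hfz, mul_zero]
    · by_contra hinf
      -- A letter of `Δ_C` outside the finite set of `i` does not see the idempotent, so
      -- `s_{α,θ_α(C)}^*` sends `p_C z` to `r • s_{α,θ_α(C)}^*`, which must then be zero.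
      obtain ⟨α, hα, hαi⟩ := Set.Infinite.exists_notMem_finset hinf i.1
      have h1 : D.sStar R α (D.range α C) * (D.p R C * z) = 0 := by
        rw [← mul_assoc, sStar_mul_p, mul_assoc, hstar, mul_zero]
      have h2 : r • D.sStar R α (D.range α C) = 0 := by
        rw [hpz C hCA, mul_smul_comm, mul_sub, ← mul_assoc,
          sStar_mul_localUnit_of_notMem R _ hαi, zero_mul, sub_zero, sStar_mul_p,
          D.p_mul_sStar_of_le R (D.range α C) (le_refl (D.action α C))] at h1
        exact h1
      refine hp r hr _ hα ?_
      have h3 : r • D.p R (D.action α C) = r • D.sStar R α (D.range α C) *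
          D.s R α (D.range α C) := by
        rw [smul_mul_assoc, sStar_mul_s_same, inf_idem]
        rfl
      rw [h3, h2, zero_mul, map_zero]
  have hzq : z = r • D.q R A hreg.finite_delta := by
    -- Beyond this index the idempotent cut by `p_A` is exactly the sum in `q_A`: letters outside
    -- `Δ_A` contribute nothing.
    obtain ⟨j, hj, hj'⟩ := (hz.and (eventually_ge_atTop
      ((hreg.finite_delta.toFinset, fun α => D.range α A) : D.LocalIndex))).exists
    rw [hj, q, localUnit_mul_p]
    congr 2
    rw [← Finset.sum_subset hj'.1]
    · refine Finset.sum_congr rfl fun α _ => ?_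
      have h1 : D.cut (j.2 α) (D.action α A) = D.range α A :=
        Subtype.ext (inf_eq_right.2 (hj'.2 α))
      rw [h1]
    · intro α _ hα
      have h1 : D.action α A = ⊥ := by
        by_contra h
        exact hα ((Set.Finite.mem_toFinset _).2 h)
      rw [← s_mul_p, h1, p_bot, mul_zero, zero_mul]
  by_cases hJ : A ∈ D.J
  · apply hz0
    rw [hzq, q, ← D.p_eq_sum R hJ, sub_self, smul_zero]
  · exact hq r hr A hreg hJ (hzq ▸ hfz)

theorem eq_zero_of_mem_level
    (hp : ∀ r : R, r ≠ 0 → ∀ A : B, A ≠ ⊥ → f (r • D.p R A) ≠ 0)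
    (hq : ∀ r : R, r ≠ 0 → ∀ (A : B) (hA : D.IsRegular A), A ∉ D.J →
      f (r • D.q R A hA.finite_delta) ≠ 0)
    {k : ℕ} {x : D.Alg R} (hx : x ∈ D.level R k) (hfx : f x = 0) : x = 0 := by
  induction k generalizing x with
  | zero =>
    obtain ⟨A, hA⟩ := (eventually_p_mul hx).exists
    rw [← hA]
    refine forall_of_locally_scalar hx (fun A => D.p R A * x = 0)
      (fun A C hA hC => p_sup_mul_eq_zero hA hC) (fun A r hr => ?_) A
    by_contra h0
    rw [hr] at h0
    refine hp r (fun h => h0 (by rw [h, zero_smul])) A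
      (fun h => h0 (by rw [h, p_bot, smul_zero])) ?_
    rw [← hr, map_mul, hfx, mul_zero]
  | succ k ih =>
    have hcorner : ∀ i : D.LocalIndex, D.localUnit R i * x * D.localUnit R i = 0 := by
      refine fun i => mul_localUnit_eq_zero (fun β C' => ?_) i
      rw [localUnit, Finset.sum_mul, Finset.sum_mul]
      refine Finset.sum_eq_zero fun α _ => ?_
      have h := ih (sStar_mul_mul_s_mem_level hx α (i.2 α) β C') (by
        rw [map_mul, map_mul, hfx, mul_zero, zero_mul])
      rw [mul_assoc, mul_assoc, ← mul_assoc (D.sStar R α (i.2 α)), h, mul_zero]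
    obtain ⟨x₀, hx₀, y, hy, rfl⟩ := Submodule.mem_sup.1 hx
    have hy₁ : ∀ᶠ i in atTop, D.localUnit R i * y = y := by
      refine eventually_localUnit_mul (Submodule.span_mono ?_ hy)
      rintro _ ⟨α, C, β, C', y, -, rfl⟩
      exact ⟨α, C, _, mul_assoc _ _ _⟩
    have hy₂ : ∀ᶠ i in atTop, y * D.localUnit R i = y := by
      refine eventually_mul_localUnit (Submodule.span_mono ?_ hy)
      rintro _ ⟨α, C, β, C', y, -, rfl⟩
      exact ⟨β, C', _, rfl⟩
    -- Expanding the vanishing corner gives `e_i x₀ + y = 0`, as `e_i` commutes with `x₀` and fixes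
    -- `y` on both sides.
    have hx₁ : ∀ᶠ i in atTop, x₀ + y = x₀ - D.localUnit R i * x₀ := by
      filter_upwards [hy₁, hy₂] with i h₁ h₂
      have h := hcorner i
      rw [mul_add, h₁, add_mul, h₂, mul_assoc, mul_localUnit_comm_of_mem_span_p hx₀, ← mul_assoc,
        localUnit_mul_self] at h
      rw [eq_neg_of_add_eq_zero_right h, sub_eq_add_neg]
    obtain ⟨A, hA⟩ := (eventually_p_mul hx₀).exists
    have hA' : D.p R A * (x₀ + y) = x₀ + y := by
      obtain ⟨i, hi⟩ := hx₁.exists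
      rw [hi, mul_sub, ← mul_assoc, p_mul_localUnit, mul_assoc, hA]
    rw [← hA']
    refine forall_of_locally_scalar hx₀ (fun A => D.p R A * (x₀ + y) = 0)
      (fun A C hA hC => p_sup_mul_eq_zero hA hC) (fun A r hr => ?_) A
    refine eq_zero_of_eventually_eq hp hq (r := r) (A := A) (by rw [map_mul, hfx, mul_zero]) ?_
    filter_upwards [hx₁] with i hi
    rw [hi, mul_sub, ← mul_assoc, p_mul_localUnit, mul_assoc, hr, mul_smul_comm, smul_sub]

theorem eq_zero_of_mem_gradedPart
    (hp : ∀ r : R, r ≠ 0 → ∀ A : B, A ≠ ⊥ → f (r • D.p R A) ≠ 0)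
    (hq : ∀ r : R, r ≠ 0 → ∀ (A : B) (hA : D.IsRegular A), A ∉ D.J →
      f (r • D.q R A hA.finite_delta) ≠ 0)
    {n : ℤ} {x : D.Alg R} (hx : x ∈ D.gradedPart R n) (hfx : f x = 0) : x = 0 := by
  induction n using Int.induction_on generalizing x with
  | zero =>
    obtain ⟨k, hk⟩ := exists_mem_level hx
    exact eq_zero_of_mem_level hp hq hk hfx
  | succ n ih =>
    obtain ⟨i, hi⟩ := (eventually_localUnit_mul (mem_span_s hx)).exists
    rw [← hi]
    refine localUnit_mul_eq_zero (fun α C => ih ?_ (by rw [map_mul, hfx, mul_zero])) i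
    simpa using mul_mem_gradedPart (sStar_mem_gradedPart α C) hx
  | pred n ih =>
    rw [← neg_add'] at hx
    obtain ⟨i, hi⟩ := (eventually_mul_localUnit (mem_span_sStar hx)).exists
    rw [← hi]
    refine mul_localUnit_eq_zero (fun α C => ih ?_ (by rw [map_mul, hfx, zero_mul])) i
    simpa using mul_mem_gradedPart hx (s_mem_gradedPart α C)

end Uniqueness

end RelBooleanSystem

/-! ### The graded uniqueness theorem -/

theorem mainTheorem2 {R : Type*} [CommRing R] {B : Type*} [GeneralizedBooleanAlgebra B]
    {L : Type*} (D : RelBooleanSystem B L)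
    {E : Type*} [NonUnitalRing E] [Module R E] [IsScalarTower R E E] [SMulCommClass R E E]
    (𝓔 : ℤ → Submodule R E) [SetLike.GradedMul 𝓔] [DirectSum.Decomposition 𝓔]
    (f : D.Alg R →ₙₐ[R] E) (hf : ∀ (n : ℤ), ∀ x ∈ D.gradedPart R n, f x ∈ 𝓔 n) :
    Function.Injective f ↔
      (∀ (r : R), r ≠ 0 → ∀ (A : B), A ≠ ⊥ → f (r • D.p R A) ≠ 0) ∧
      (∀ (r : R), r ≠ 0 → ∀ (A : B) (hA : D.IsRegular A), A ∉ D.J →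
        f (r • D.q R A hA.finite_delta) ≠ 0) := by
  constructor
  · intro hinj
    exact ⟨fun r hr A hA => (map_ne_zero_iff f hinj).2 (D.smul_p_ne_zero R hr hA),
      fun r hr A hA hJ => (map_ne_zero_iff f hinj).2 (D.smul_q_ne_zero R hr _ hJ)⟩
  · rintro ⟨hp, hq⟩
    rw [injective_iff_map_eq_zero]
    intro x hx
    obtain ⟨c, hc, rfl⟩ := RelBooleanSystem.exists_finsupp_gradedPart x
    refine Finset.sum_eq_zero fun n _ =>
      RelBooleanSystem.eq_zero_of_mem_gradedPart hp hq (hc n) ?_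
    by_cases hn : n ∈ c.support
    · rw [Finsupp.sum, map_sum] at hx
      -- Projecting `f x = 0` onto degree `n` of the target isolates the image of the component `c
      -- n`.
      have h := congrArg (DirectSum.component R ℤ (fun i => 𝓔 i) n ∘ₗ
        (DirectSum.decomposeLinearEquiv 𝓔).toLinearMap) hx
      rw [map_sum, map_zero] at h
      replace h := (Finset.sum_eq_single_of_mem n hn fun k _ hk => Subtype.ext
        (DirectSum.decompose_of_mem_ne 𝓔 (hf k _ (hc k)) hk)).symm.trans h
      exact (DirectSum.decompose_of_mem_same 𝓔 (hf n _ (hc n))).symm.trans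
        (congrArg Subtype.val h)
    · rw [Finsupp.notMem_support_iff.1 hn, map_zero]
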